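/- **Online convex covering.** Let $f:\mathbb{R}_+^n\to\mathbb{R}_+$ be a cost function known in advance. Covering requests arrive one by one; request $k$ is a non-negative, non-zero vector $\vec a_k\in\mathbb{R}_+^n$ and asks for $\langle \vec a_k,\vec x\rangle\ge 1$. A (deterministic) online covering algorithm maintains $\vec x\in\mathbb{R}_+^n$; when a request arrives it must, knowing only the requests that have arrived so far, increase coordinates of $\vec x$ so that the request is satisfied, and it may never decrease a coordinate. It is $R$-competitive if, after every finite sequence of requests, $f(\vec x)\le R\cdot f(\vec x^{*})$ for every $\vec x^{*}\in\mathbb{R}_+^n$ that satisfies all the requests of the sequence. **Theorem.** There is an absolute constant $K>0$ such that the following holds for every $n$ and every polynomial $f$ in $n$ real variables that has non-negative coefficients and is convex on $\mathbb{R}_+^n$. (a) If $f$ is homogeneous of degree $\tau$, then there is a $\bigl(K\,\tau\log\max\{n,2\}\bigr)^{\tau}$-competitive online covering algorithm for $f$. (b) If $f$ has maximum degree (at most) $\tau$ and is a sum of (at most) $N$ monomials, then there is a $\bigl(K\,\tau\log\max\{N,2\}\bigr)^{\tau}$-competitive online covering algorithm for $f$. Here $\log$ is the natural logarithm and $0^0=1$.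 Thus the ratios are $O(\tau\log n)^{\tau}$ for $n\ge 2$ and $O(\tau\log N)^{\tau}$ for $N\ge 2$, respectively. -/

import Mathlib

namespace OnlineCovering

/-- A covering request `∑ i, a i * x i ≥ 1` on `n` resources: a non-negative vector `a`.
It has some positive entry, i.e. the request is satisfiable. -/
structure Request (n : ℕ) where
  /-- the coefficients of the constraint -/
  a : Fin n → ℝ
  nonneg : ∀ i, 0 ≤ a i
  satisfiable : ∃ i, 0 < a i

/-- The assignment `x` satisfies the request `r`. -/
def Request.SatisfiedBy {n : ℕ} (r : Request n) (x : Fin n → ℝ) : Prop :=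
  1 ≤ ∑ i, r.a i * x i

/-- Feasible solutions of the offline covering program given by the requests `σ`. -/
def Feasible {n : ℕ} (σ : List (Request n)) (x : Fin n → ℝ) : Prop :=
  (∀ i, 0 ≤ x i) ∧ ∀ r ∈ σ, r.SatisfiedBy x

/-- A deterministic online covering algorithm on `n` resources. `solution σ` is the assignment
held after exactly the requests of `σ` have arrived, in this order; it is a function of the past
requests only, it is always feasible for them, and no coordinate ever decreases. -/
structure OnlineAlgorithm (n : ℕ) where
  /-- the assignment held after a sequence of requests -/
  solution : List (Request n) → Fin n → ℝ
  feasible : ∀ σ, Feasible σ (solution σ)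
  nondecreasing : ∀ (σ : List (Request n)) (r : Request n) (i : Fin n),
    solution σ i ≤ solution (σ ++ [r]) i

/-- The algorithm is `R`-competitive for the cost `f`: after every finite sequence of requests
its cost is at most `R` times the cost of every offline feasible solution. -/
def OnlineAlgorithm.IsCompetitive {n : ℕ} (alg : OnlineAlgorithm n)
    (f : (Fin n → ℝ) → ℝ) (R : ℝ) : Prop :=
  ∀ (σ : List (Request n)) (x : Fin n → ℝ), Feasible σ x → f (alg.solution σ) ≤ R * f x

/-- The polynomial `p` is an admissible cost: its coefficients are non-negative, and it is convex
as a function on the non-negative orthant. -/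
def IsConvexCost {n : ℕ} (p : MvPolynomial (Fin n) ℝ) : Prop :=
  (∀ d, 0 ≤ p.coeff d) ∧
    ConvexOn ℝ {x : Fin n → ℝ | ∀ i, 0 ≤ x i} (fun x => MvPolynomial.eval x p)

end OnlineCovering

namespace OnlineCovering

/-! After dropping the constant term, such a polynomial has a non-negative, coordinatewise monotone
gradient `g`, satisfies `⟨g x, x⟩ ≤ τ f x`, and grows by at most `c ^ τ` under scaling by `c ≥ 1`.
The algorithm uses only these facts together with convexity and continuity.

Suppose the optimum is at most a known budget `α`. A multiplicative update raises `x j` at relative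
rate proportional to `a j / g j x`. Its cost is at most 6 times the gain of `∑ j, g j · s j · log (x
j)` for every comparator `s` satisfying the request (`exists_charged_step`). Monotonicity of `g`
lets these charges telescope (`charged_trans`). If the start `z` has `z j ≥ 24 τ s j / M` on the
coordinates that cost something, then `log (x j / z j)` is at most `log M` plus a term linear in `x
j / s j`. Euler's bound makes the linear part a small fraction of `f x`, and the tangent inequality
at `x` towards a scaled copy of `s` bounds the rest, so `f x` is `O(f z) + O(τ log M) ^ τ α`
(`le_of_charged`). Averaging single-coordinate points gives a cheap start (`exists_floor`).

When the budget becomes too small, a new phase starts with budget `4 * 2 ^ τ` times the current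
optimum, large enough to absorb the cost already incurred.

Coordinates with zero cost alone are free everywhere, so `M` need only bound the number of costly
ones: at most `n`, and at most the number of monomials (`card_costly_le_card_support`). -/

/-- A convex cost vanishing at the origin, with a non-negative monotone (sub)gradient `g`,
growing at most like a polynomial of degree `τ`. -/
structure IsMonotoneGradientCost {n : ℕ} (τ : ℕ) (f : (Fin n → ℝ) → ℝ)
    (g : Fin n → (Fin n → ℝ) → ℝ) : Prop where
  map_zero : f 0 = 0
  convexOn : ConvexOn ℝ {x : Fin n → ℝ | ∀ i, 0 ≤ x i} f
  continuous : Continuous f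
  grad_nonneg : ∀ j x, 0 ≤ x → 0 ≤ g j x
  grad_mono : ∀ j x y, 0 ≤ x → x ≤ y → g j x ≤ g j y
  add_grad_le : ∀ x y, 0 ≤ x → 0 ≤ y → f x + ∑ j, g j x * (y j - x j) ≤ f y
  sum_grad_mul_le : ∀ x, 0 ≤ x → ∑ j, g j x * x j ≤ τ * f x
  map_smul_le : ∀ (c : ℝ) x, 1 ≤ c → 0 ≤ x → f (c • x) ≤ c ^ τ * f x
  grad_smul_le : ∀ j (c : ℝ) x, 1 ≤ c → 0 ≤ x → g j (c • x) ≤ c ^ τ * g j x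

/-! ### Polynomials with non-negative coefficients -/

section Polynomial

open MvPolynomial

variable {n : ℕ}

theorem eval_nonneg_of_coeff_nonneg {p : MvPolynomial (Fin n) ℝ} (hp : ∀ d, 0 ≤ p.coeff d)
    {x : Fin n → ℝ} (hx : 0 ≤ x) : 0 ≤ eval x p := by
  rw [eval_eq']
  exact Finset.sum_nonneg fun d _ => mul_nonneg (hp d)
    (Finset.prod_nonneg fun i _ => pow_nonneg (hx i) _)

theorem eval_mono_of_coeff_nonneg {p : MvPolynomial (Fin n) ℝ} (hp : ∀ d, 0 ≤ p.coeff d)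
    {x y : Fin n → ℝ} (hx : 0 ≤ x) (hxy : x ≤ y) : eval x p ≤ eval y p := by
  rw [eval_eq', eval_eq']
  refine Finset.sum_le_sum fun d _ => mul_le_mul_of_nonneg_left ?_ (hp d)
  exact Finset.prod_le_prod (fun i _ => pow_nonneg (hx i) _)
    fun i _ => pow_le_pow_left₀ (hx i) (hxy i) _

theorem eval_smul_le_of_coeff_nonneg {p : MvPolynomial (Fin n) ℝ} (hp : ∀ d, 0 ≤ p.coeff d)
    {τ : ℕ} (hτ : p.totalDegree ≤ τ) {c : ℝ} (hc : 1 ≤ c) {x : Fin n → ℝ} (hx : 0 ≤ x) :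
    eval (c • x) p ≤ c ^ τ * eval x p := by
  rw [eval_eq', eval_eq', Finset.mul_sum]
  refine Finset.sum_le_sum fun d hd => ?_
  have hdeg : ∑ i, d i ≤ τ := by
    have := (le_totalDegree hd).trans hτ
    rwa [Finsupp.sum_fintype _ _ (fun _ => rfl)] at this
  simp only [Pi.smul_apply, smul_eq_mul, mul_pow]
  rw [Finset.prod_mul_distrib, Finset.prod_pow_eq_pow_sum, mul_left_comm]
  exact mul_le_mul_of_nonneg_right (pow_le_pow_right₀ hc hdeg)
    (mul_nonneg (hp d) (Finset.prod_nonneg fun i _ => pow_nonneg (hx i) _))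

theorem coeff_pderiv_nonneg {p : MvPolynomial (Fin n) ℝ} (hp : ∀ d, 0 ≤ p.coeff d) (j : Fin n)
    (d : Fin n →₀ ℕ) : 0 ≤ (pderiv j p).coeff d := by
  rw [coeff_pderiv]
  exact mul_nonneg (hp _) (by positivity)

theorem totalDegree_pderiv_le (p : MvPolynomial (Fin n) ℝ) (j : Fin n) :
    (pderiv j p).totalDegree ≤ p.totalDegree := by
  refine Finset.sup_le fun d hd => ?_
  have h : d + Finsupp.single j 1 ∈ p.support := by
    rw [mem_support_iff, coeff_pderiv] at hd
    exact mem_support_iff.2 (left_ne_zero_of_mul hd)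
  refine le_trans ?_ (le_totalDegree h)
  rw [Finsupp.sum_fintype _ _ (fun _ => rfl), Finsupp.sum_fintype _ _ (fun _ => rfl)]
  exact Finset.sum_le_sum fun i _ => by simp

/-- Euler's identity applied monomial by monomial: `x j ∂/∂x j` multiplies a monomial by its
exponent of `j`. -/
theorem sum_eval_pderiv_mul (p : MvPolynomial (Fin n) ℝ) (x : Fin n → ℝ) :
    ∑ j, eval x (pderiv j p) * x j
      = ∑ d ∈ p.support, ((∑ j, d j : ℕ) : ℝ) * (p.coeff d * ∏ i, x i ^ d i) := by
  have h1 : ∀ j, eval x (pderiv j p) * x j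
      = ∑ d ∈ p.support, (d j : ℝ) * (p.coeff d * ∏ i, x i ^ d i) := by
    intro j
    have : eval x (pderiv j p) * x j = eval x (X j * pderiv j p) := by simp [mul_comm]
    rw [this]
    conv_lhs => rw [p.as_sum]
    simp only [map_sum, Finset.mul_sum, X_mul_pderiv_monomial]
    refine Finset.sum_congr rfl fun d _ => ?_
    rw [map_nsmul, nsmul_eq_mul, eval_monomial, Finsupp.prod_fintype _ _ (by simp)]
  simp_rw [h1]
  rw [Finset.sum_comm]
  refine Finset.sum_congr rfl fun d _ => ?_
  rw [← Finset.sum_mul, Nat.cast_sum]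

theorem sum_eval_pderiv_mul_le {p : MvPolynomial (Fin n) ℝ} (hp : ∀ d, 0 ≤ p.coeff d)
    {τ : ℕ} (hτ : p.totalDegree ≤ τ) {x : Fin n → ℝ} (hx : 0 ≤ x) :
    ∑ j, eval x (pderiv j p) * x j ≤ τ * eval x p := by
  rw [sum_eval_pderiv_mul, eval_eq', Finset.mul_sum]
  refine Finset.sum_le_sum fun d hd => mul_le_mul_of_nonneg_right ?_ (mul_nonneg (hp d)
    (Finset.prod_nonneg fun i _ => pow_nonneg (hx i) _))
  have := (le_totalDegree hd).trans hτ
  rw [Finsupp.sum_fintype _ _ (fun _ => rfl)] at this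
  exact_mod_cast this

theorem hasDerivAt_eval_add_smul (p : MvPolynomial (Fin n) ℝ) (x v : Fin n → ℝ) (t : ℝ) :
    HasDerivAt (fun s : ℝ => eval (x + s • v) p)
      (∑ j, eval (x + t • v) (pderiv j p) * v j) t := by
  induction p using MvPolynomial.induction_on with
  | C a => simpa using hasDerivAt_const t a
  | add p q hp hq =>
    simp only [map_add, add_mul, Finset.sum_add_distrib]
    exact hp.add hq
  | mul_X p i hp =>
    have hX : HasDerivAt (fun s : ℝ => x i + s * v i) (v i) t := by
      simpa using ((hasDerivAt_id t).mul_const (v i)).const_add (x i)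
    have h := hp.mul hX
    simp only [pderiv_mul, map_add, map_mul, eval_X, Pi.add_apply, Pi.smul_apply,
      smul_eq_mul]
    refine h.congr_deriv ?_
    simp only [add_mul, Finset.sum_add_distrib]
    congr 1
    · rw [Finset.sum_mul]
      exact Finset.sum_congr rfl fun j _ => by ring
    · rw [Finset.sum_eq_single i]
      · simp
      · intro j _ hj
        rw [pderiv_X_of_ne hj.symm]
        simp
      · simp

/-- Convexity restricted to the segment from `x` to `y` gives a one-variable convex function, whose
slope over `[0, 1]` is at least its derivative at 0. -/
theorem IsConvexCost.add_pderiv_le {p : MvPolynomial (Fin n) ℝ} (hp : IsConvexCost p)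
    {x y : Fin n → ℝ} (hx : 0 ≤ x) (hy : 0 ≤ y) :
    eval x p + ∑ j, eval x (pderiv j p) * (y j - x j) ≤ eval y p := by
  have hmem : ∀ s : ℝ, 0 ≤ s → s ≤ 1 → ∀ i, 0 ≤ (x + s • (y - x)) i := by
    intro s h0 h1 i
    have : (x + s • (y - x)) i = (1 - s) * x i + s * y i := by
      simp only [Pi.add_apply, Pi.smul_apply, Pi.sub_apply, smul_eq_mul]; ring
    rw [this]
    exact add_nonneg (mul_nonneg (by linarith) (hx i)) (mul_nonneg h0 (hy i))
  have hconv : ConvexOn ℝ (Set.Icc (0 : ℝ) 1) (fun s : ℝ => eval (x + s • (y - x)) p) := by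
    refine ⟨convex_Icc 0 1, fun s hs t ht a b ha hb hab => ?_⟩
    have h := hp.2.2 (hmem s hs.1 hs.2) (hmem t ht.1 ht.2) ha hb hab
    have heq : x + (a • s + b • t) • (y - x)
        = a • (x + s • (y - x)) + b • (x + t • (y - x)) := by
      ext i
      simp only [Pi.add_apply, Pi.smul_apply, Pi.sub_apply, smul_eq_mul]
      linear_combination -(x i) * hab
    simp only [heq]
    exact h
  have hd := hasDerivAt_eval_add_smul p x (y - x) 0
  have h := hconv.le_slope_of_hasDerivAt (by simp) (by simp) zero_lt_one hd
  simp only [slope_def_field, zero_smul, add_zero, one_smul, add_sub_cancel, sub_zero, div_one,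
    Pi.sub_apply] at h
  linarith

theorem IsConvexCost.isMonotoneGradientCost {p : MvPolynomial (Fin n) ℝ} (hp : IsConvexCost p)
    {τ : ℕ} (hτ : p.totalDegree ≤ τ) (h0 : eval 0 p = 0) :
    IsMonotoneGradientCost τ (fun x => eval x p) (fun j x => eval x (pderiv j p)) where
  map_zero := h0
  convexOn := hp.2
  continuous := p.continuous_eval
  grad_nonneg j _ hx := eval_nonneg_of_coeff_nonneg (coeff_pderiv_nonneg hp.1 j) hx
  grad_mono j _ _ hx hxy := eval_mono_of_coeff_nonneg (coeff_pderiv_nonneg hp.1 j) hx hxy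
  add_grad_le _ _ hx hy := hp.add_pderiv_le hx hy
  sum_grad_mul_le _ hx := sum_eval_pderiv_mul_le hp.1 hτ hx
  map_smul_le _ _ hc hx := eval_smul_le_of_coeff_nonneg hp.1 hτ hc hx
  grad_smul_le j _ _ hc hx := eval_smul_le_of_coeff_nonneg (coeff_pderiv_nonneg hp.1 j)
    ((totalDegree_pderiv_le p j).trans hτ) hc hx

/-- Removing the constant term keeps a polynomial an admissible cost. -/
theorem IsConvexCost.sub_C {p : MvPolynomial (Fin n) ℝ} (hp : IsConvexCost p) :
    IsConvexCost (p - C (p.coeff 0)) := by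
  refine ⟨fun d => ?_, ?_⟩
  · rw [coeff_sub, coeff_C]
    split_ifs with h
    · simp [h]
    · simpa using hp.1 d
  · simp only [map_sub, eval_C]
    simp only [sub_eq_add_neg]
    exact hp.2.add_const (-p.coeff 0)

theorem eval_zero_sub_C (p : MvPolynomial (Fin n) ℝ) : eval 0 (p - C (p.coeff 0)) = 0 := by
  simp [constantCoeff_eq]

/-- Every variable that costs something when alone has a pure power among the monomials. -/
theorem card_costly_le_card_support (p : MvPolynomial (Fin n) ℝ) :
    (Finset.univ.filter fun j : Fin n =>
      0 < eval (Pi.single j 1) (p - C (p.coeff 0))).card ≤ p.support.card := by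
  classical
  have key : ∀ j : Fin n, 0 < eval (Pi.single j 1) (p - C (p.coeff 0)) →
      ∃ d ∈ p.support, d j ≠ 0 ∧ ∀ i, i ≠ j → d i = 0 := by
    intro j hj
    by_contra! hcon
    refine hj.ne' ?_
    rw [map_sub, eval_C, eval_eq', sub_eq_zero]
    -- Without a pure power of `j`, every non-constant monomial involves another variable and
    -- vanishes at `Pi.single j 1`.
    have : ∀ d ∈ p.support, d ≠ 0 →
        p.coeff d * ∏ i, (Pi.single j (1 : ℝ) : Fin n → ℝ) i ^ d i = 0 := by
      intro d hd hd0
      obtain ⟨i, hij, hi⟩ : ∃ i, i ≠ j ∧ d i ≠ 0 := by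
        by_cases hdj : d j = 0
        · obtain ⟨i, hi⟩ := Finsupp.ne_iff.1 hd0
          exact ⟨i, fun h => hi (by simp [h, hdj]), hi⟩
        · exact hcon d hd hdj
      rw [Finset.prod_eq_zero (Finset.mem_univ i), mul_zero]
      rw [Pi.single_eq_of_ne hij, zero_pow hi]
    rw [Finset.sum_eq_single 0]
    · simp
    · exact this
    · intro h
      rw [notMem_support_iff.1 h, zero_mul]
  choose! D hD using key
  refine Finset.card_le_card_of_injOn D (fun j hj => ?_) fun j hj k hk hjk => ?_
  · exact (hD j (Finset.mem_filter.1 hj).2).1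
  · by_contra hne
    have h1 := hD j (Finset.mem_filter.1 hj).2
    have h2 := hD k (Finset.mem_filter.1 hk).2
    exact h1.2.1 (hjk ▸ h2.2.2 j hne)

end Polynomial

end OnlineCovering

/-! ### Requests, and costly versus free coordinates -/

namespace OnlineCovering

variable {n : ℕ}

/-- An invariant that can be maintained by increasing coordinates is maintained by some
online algorithm. -/
theorem exists_onlineAlgorithm_of_invariant (Inv : List (Request n) → (Fin n → ℝ) → Prop)
    (hfeas : ∀ σ x, Inv σ x → Feasible σ x) (hnil : ∃ x, Inv [] x)
    (hstep : ∀ σ x r, Inv σ x → ∃ y, Inv (σ ++ [r]) y ∧ x ≤ y) :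
    ∃ alg : OnlineAlgorithm n, ∀ σ, Inv σ (alg.solution σ) := by
  classical
  choose next hnext using hstep
  let run : ∀ σ : List (Request n), {x // Inv σ x} := fun σ =>
    σ.reverseRecOn (motive := fun σ => {x // Inv σ x}) ⟨hnil.choose, hnil.choose_spec⟩
      fun σ r s => ⟨next σ s.1 r s.2, (hnext σ s.1 r s.2).1⟩
  refine ⟨⟨fun σ => (run σ).1, fun σ => hfeas _ _ (run σ).2, fun σ r i => ?_⟩,
    fun σ => (run σ).2⟩
  have h : run (σ ++ [r]) = ⟨next σ (run σ).1 r (run σ).2, (hnext σ (run σ).1 r (run σ).2).1⟩ :=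
    List.reverseRecOn_concat (motive := fun σ => {x // Inv σ x}) r σ _ _
  simp only [h]
  exact (hnext σ (run σ).1 r (run σ).2).2 i

theorem Request.SatisfiedBy.mono {r : Request n} {x y : Fin n → ℝ} (h : r.SatisfiedBy x)
    (hxy : x ≤ y) : r.SatisfiedBy y :=
  le_trans (α := ℝ) h
    (Finset.sum_le_sum fun i _ => mul_le_mul_of_nonneg_left (hxy i) (r.nonneg i))

theorem Request.satisfiedBy_of_coord {r : Request n} {x : Fin n → ℝ} (hx : 0 ≤ x) {j : Fin n}
    (h : 1 ≤ r.a j * x j) : r.SatisfiedBy x :=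
  h.trans (Finset.single_le_sum (f := fun i => r.a i * x i)
    (fun i _ => mul_nonneg (r.nonneg i) (hx i)) (Finset.mem_univ j))

theorem Feasible.concat {σ : List (Request n)} {x y : Fin n → ℝ} (h : Feasible σ x)
    (hxy : x ≤ y) {r : Request n} (hr : r.SatisfiedBy y) : Feasible (σ ++ [r]) y := by
  refine ⟨fun i => (h.1 i).trans (hxy i), fun q hq => ?_⟩
  rcases List.mem_append.1 hq with hq | hq
  · exact (h.2 q hq).mono hxy
  · rw [List.mem_singleton.1 hq]
    exact hr

theorem Feasible.of_concat {σ : List (Request n)} {x : Fin n → ℝ} {r : Request n}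
    (h : Feasible (σ ++ [r]) x) : Feasible σ x :=
  ⟨h.1, fun q hq => h.2 q (by simp [hq])⟩

theorem Feasible.satisfiedBy_last {σ : List (Request n)} {x : Fin n → ℝ} {r : Request n}
    (h : Feasible (σ ++ [r]) x) : r.SatisfiedBy x :=
  h.2 r (by simp)

/-- Raising `x` so that the coordinate `j` alone satisfies a request. -/
theorem Request.exists_raise {r : Request n} {j : Fin n} (hj : 0 < r.a j) {x : Fin n → ℝ}
    (hx : 0 ≤ x) : ∃ y, x ≤ y ∧ r.SatisfiedBy y ∧ ∀ i, i ≠ j → y i = x i := by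
  classical
  have hle : x ≤ Function.update x j (max (x j) (r.a j)⁻¹) := by
    intro i
    by_cases h : i = j
    · subst h; simp
    · simp [h]
  refine ⟨_, hle, Request.satisfiedBy_of_coord (hx.trans hle) (j := j) ?_, fun i hi => by simp [hi]⟩
  rw [Function.update_self]
  calc (1 : ℝ) = r.a j * (r.a j)⁻¹ := (mul_inv_cancel₀ hj.ne').symm
    _ ≤ _ := mul_le_mul_of_nonneg_left (le_max_right _ _) hj.le

namespace IsMonotoneGradientCost

variable {τ : ℕ} {f : (Fin n → ℝ) → ℝ} {g : Fin n → (Fin n → ℝ) → ℝ}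

theorem mono (hf : IsMonotoneGradientCost τ f g) {x y : Fin n → ℝ} (hx : 0 ≤ x) (hxy : x ≤ y) :
    f x ≤ f y := by
  have h := hf.add_grad_le x y hx (hx.trans hxy)
  have : 0 ≤ ∑ j, g j x * (y j - x j) :=
    Finset.sum_nonneg fun j _ => mul_nonneg (hf.grad_nonneg j x hx) (sub_nonneg.2 (hxy j))
  linarith

theorem nonneg (hf : IsMonotoneGradientCost τ f g) {x : Fin n → ℝ} (hx : 0 ≤ x) : 0 ≤ f x :=
  hf.map_zero ▸ hf.mono le_rfl hx

theorem map_smul_le_of_le_one (hf : IsMonotoneGradientCost τ f g) {c : ℝ} (h0 : 0 ≤ c)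
    (h1 : c ≤ 1) {x : Fin n → ℝ} (hx : 0 ≤ x) : f (c • x) ≤ c * f x := by
  have h := hf.convexOn.2 (x := x) (y := 0) hx (fun _ => le_rfl) h0 (sub_nonneg.2 h1) (by ring)
  simpa [hf.map_zero] using h

theorem mul_le_map_smul (hf : IsMonotoneGradientCost τ f g) {c : ℝ} (h1 : 1 ≤ c)
    {x : Fin n → ℝ} (hx : 0 ≤ x) : c * f x ≤ f (c • x) := by
  have hc : 0 < c := by linarith
  have h := hf.map_smul_le_of_le_one (c := c⁻¹) (by positivity) (inv_le_one_of_one_le₀ h1)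
    (smul_nonneg hc.le hx)
  rw [smul_smul, inv_mul_cancel₀ hc.ne', one_smul] at h
  rwa [inv_mul_eq_div, le_div_iff₀ hc, mul_comm] at h

/-- Convexity at the midpoint, then scaling by 2. This pays for adding a new start to the old
assignment when a phase begins. -/
theorem map_add_le (hf : IsMonotoneGradientCost τ f g) {x y : Fin n → ℝ} (hx : 0 ≤ x)
    (hy : 0 ≤ y) : f (x + y) ≤ 2 ^ τ * (f x + f y) := by
  have h := hf.convexOn.2 (x := x) (y := y) hx hy (by norm_num : (0 : ℝ) ≤ 1 / 2)
    (by norm_num : (0 : ℝ) ≤ 1 / 2) (by norm_num)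
  have h2 := hf.map_smul_le 2 ((1 / 2 : ℝ) • x + (1 / 2 : ℝ) • y) one_le_two
    (add_nonneg (smul_nonneg (by norm_num) hx) (smul_nonneg (by norm_num) hy))
  have heq : (2 : ℝ) • ((1 / 2 : ℝ) • x + (1 / 2 : ℝ) • y) = x + y := by
    rw [smul_add, smul_smul, smul_smul]; norm_num
  rw [heq] at h2
  refine h2.trans (mul_le_mul_of_nonneg_left ?_ (by positivity))
  have := hf.nonneg hx
  have := hf.nonneg hy
  simp only [smul_eq_mul] at h
  linarith

theorem map_single_pos (hf : IsMonotoneGradientCost τ f g) {j : Fin n}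
    (hj : 0 < f (Pi.single j 1)) {t : ℝ} (ht : 0 < t) : 0 < f (Pi.single j t) := by
  have h1 : (0 : Fin n → ℝ) ≤ Pi.single j 1 := Pi.single_nonneg.2 zero_le_one
  have h : ∀ c : ℝ, c • (Pi.single j 1 : Fin n → ℝ) = Pi.single j c := fun c => by
    rw [← Pi.single_smul, smul_eq_mul, mul_one]
  rcases le_total 1 t with h1t | h1t
  · have := hf.mul_le_map_smul h1t h1
    rw [h] at this
    exact (mul_pos ht hj).trans_le this
  · have := hf.map_smul_le t⁻¹ (Pi.single j t) ((one_le_inv₀ ht).2 h1t)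
      (Pi.single_nonneg.2 ht.le)
    rw [← Pi.single_smul, smul_eq_mul, inv_mul_cancel₀ ht.ne'] at this
    exact pos_of_mul_pos_right (hj.trans_le this) (by positivity)

theorem single_nonneg {j : Fin n} {t : ℝ} (ht : 0 ≤ t) :
    (0 : Fin n → ℝ) ≤ Pi.single j t :=
  Pi.single_nonneg.2 ht

theorem single_le {x : Fin n → ℝ} (hx : 0 ≤ x) (j : Fin n) : Pi.single j (x j) ≤ x := by
  intro i
  by_cases h : i = j
  · subst h; simp
  · simpa [h] using hx i

/-- The tangent inequality from `Pi.single j (x j)` to the origin makes the derivative positive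
there; monotonicity of the gradient carries this up to `x`. -/
theorem grad_pos (hf : IsMonotoneGradientCost τ f g) {j : Fin n}
    (hj : 0 < f (Pi.single j 1)) {x : Fin n → ℝ} (hx : 0 ≤ x) (hxj : 0 < x j) : 0 < g j x := by
  have hs : (0 : Fin n → ℝ) ≤ Pi.single j (x j) := Pi.single_nonneg.2 hxj.le
  refine lt_of_lt_of_le ?_ (hf.grad_mono j _ _ hs (single_le hx j))
  have h := hf.add_grad_le (Pi.single j (x j)) 0 hs le_rfl
  have hsum : ∑ i, g i (Pi.single j (x j)) * ((0 : Fin n → ℝ) i - (Pi.single j (x j) : Fin n → ℝ) i)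
      = -(g j (Pi.single j (x j)) * x j) := by
    rw [Finset.sum_eq_single j]
    · simp
    · intro i _ hi; simp [hi]
    · simp
  rw [hsum, hf.map_zero] at h
  have := hf.map_single_pos hj hxj
  exact pos_of_mul_pos_left (by linarith) hxj.le

/-- A coordinate that is free when alone is free everywhere. -/
theorem map_add_single_le (hf : IsMonotoneGradientCost τ f g) {j : Fin n}
    (hj : ¬ 0 < f (Pi.single j 1)) {x : Fin n → ℝ} (hx : 0 ≤ x) {t : ℝ} (ht : 0 ≤ t) :
    f (x + Pi.single j t) ≤ f x := by
  have hfree : ∀ s : ℝ, 0 ≤ s → f (Pi.single j s) = 0 := by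
    intro s hs
    rcases hs.eq_or_lt with rfl | hs
    · simpa using hf.map_zero
    refine le_antisymm ?_ (hf.nonneg (Pi.single_nonneg.2 hs.le))
    by_contra! hpos
    refine hj ?_
    have h1 : (0 : Fin n → ℝ) ≤ Pi.single j 1 := Pi.single_nonneg.2 zero_le_one
    have hm := hf.mono (x := Pi.single j s) (y := max 1 s • Pi.single j 1)
      (Pi.single_nonneg.2 hs.le) (by
        rw [← Pi.single_smul, smul_eq_mul, mul_one]
        exact Pi.single_le_single.2 (le_max_right _ _))
    exact pos_of_mul_pos_right (hpos.trans_le (hm.trans (hf.map_smul_le _ _ (le_max_left _ _) h1)))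
      (by positivity)
  -- A convex combination of `x` with the point `t / ε` on axis `j`, which costs nothing; then `ε →
  -- 0`.
  have hev : ∀ ε : ℝ, 0 < ε → ε < 1 → f ((1 - ε) • x + Pi.single j t) ≤ f x := by
    intro ε h0 h1
    have h := hf.convexOn.2 (x := x) (y := Pi.single j (t / ε)) hx
      (single_nonneg (by positivity))
      (sub_nonneg.2 h1.le) h0.le (by ring)
    rw [hfree _ (by positivity), ← Pi.single_smul, smul_eq_mul, mul_div_cancel₀ _ h0.ne'] at h
    have := hf.nonneg hx
    simp only [smul_eq_mul] at h
    nlinarith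
  have hlim : Filter.Tendsto (fun ε : ℝ => f ((1 - ε) • x + Pi.single j t))
      (nhdsWithin 0 (Set.Ioi 0)) (nhds (f ((1 - (0 : ℝ)) • x + Pi.single j t))) := by
    have hc : Continuous fun ε : ℝ => f ((1 - ε) • x + Pi.single j t) :=
      hf.continuous.comp (by fun_prop)
    exact (hc.tendsto 0).mono_left nhdsWithin_le_nhds
  rw [sub_zero, one_smul] at hlim
  refine le_of_tendsto hlim ?_
  filter_upwards [Ioo_mem_nhdsGT (zero_lt_one (α := ℝ))] with ε hε using hev ε hε.1 hε.2

theorem map_le_of_le_on_costly (hf : IsMonotoneGradientCost τ f g) {x y : Fin n → ℝ}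
    (hx : 0 ≤ x) (hy : 0 ≤ y) (h : ∀ j, 0 < f (Pi.single j 1) → y j ≤ x j) : f y ≤ f x := by
  classical
  suffices H : ∀ F : Finset (Fin n), (∀ j ∈ F, ¬ 0 < f (Pi.single j 1)) →
      ∀ x : Fin n → ℝ, 0 ≤ x → (∀ j ∉ F, y j ≤ x j) → f y ≤ f x from
    H (Finset.univ.filter fun j => ¬ 0 < f (Pi.single j 1))
      (fun j hj => (Finset.mem_filter.1 hj).2) x hx
      fun j hj => h j (by simpa using hj)
  intro F
  induction F using Finset.induction_on with
  | empty => exact fun _ x hx h => hf.mono hy fun j => h j (by simp)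
  | insert j F _ ih =>
    intro hF x hx h
    have hs : (0 : Fin n → ℝ) ≤ Pi.single j (y j) := Pi.single_nonneg.2 (hy j)
    refine (ih (fun i hi => hF i (Finset.mem_insert_of_mem hi)) (x + Pi.single j (y j))
      (add_nonneg hx hs) fun i hi => ?_).trans
      (hf.map_add_single_le (hF j (Finset.mem_insert_self _ _)) hx (hy j))
    by_cases hij : i = j
    · subst hij
      simpa using hx i
    · exact (h i (by simp [hij, hi])).trans (le_add_of_nonneg_right (hs i))

theorem grad_eq_zero (hf : IsMonotoneGradientCost τ f g) {j : Fin n}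
    (hj : ¬ 0 < f (Pi.single j 1)) {x : Fin n → ℝ} (hx : 0 ≤ x) : g j x = 0 := by
  refine le_antisymm ?_ (hf.grad_nonneg j x hx)
  have h1 : (0 : Fin n → ℝ) ≤ Pi.single j 1 := Pi.single_nonneg.2 zero_le_one
  have h := (hf.add_grad_le x (x + Pi.single j 1) hx (add_nonneg hx h1)).trans
    (hf.map_add_single_le hj hx zero_le_one)
  have hsum : ∑ i, g i x * ((x + Pi.single j 1 : Fin n → ℝ) i - x i) = g j x := by
    rw [Finset.sum_eq_single j]
    · simp
    · intro i _ hi; simp [hi]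
    · simp
  linarith

/-- For every budget `α` there is a starting point of cost `O(τ) ^ τ * α` whose costly coordinates
dominate, up to the factor `τ / M`, those of every point of cost at most `α`. -/
theorem exists_floor (hf : IsMonotoneGradientCost τ f g) {M : ℕ} (hM : 0 < M)
    (hcard : (Finset.univ.filter fun j : Fin n => 0 < f (Pi.single j 1)).card ≤ M)
    {c : ℝ} (hc : 1 ≤ c) {α : ℝ} (hα : 0 < α) :
    ∃ v : Fin n → ℝ, (∀ j, 0 < v j) ∧ f v ≤ c ^ τ * α ∧
      ∀ s, 0 ≤ s → f s ≤ α → ∀ j, 0 < f (Pi.single j 1) → c * s j / M ≤ v j := by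
  classical
  have hM' : (0 : ℝ) < M := by exact_mod_cast hM
  have hsmul : ∀ (j : Fin n) (c : ℝ), c • (Pi.single j 1 : Fin n → ℝ) = Pi.single j c :=
    fun j c => by rw [← Pi.single_smul, smul_eq_mul, mul_one]
  -- `b j` is the largest amount of `j` alone that the budget affords.
  have hb : ∀ j, 0 < f (Pi.single j 1) → ∃ b : ℝ, 0 < b ∧ f (Pi.single j b) ≤ α ∧
      ∀ t, 0 ≤ t → f (Pi.single j t) ≤ α → t ≤ b := by
    intro j hj
    have h1 : (0 : Fin n → ℝ) ≤ Pi.single j 1 := Pi.single_nonneg.2 zero_le_one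
    have hcont : Continuous fun t : ℝ => f (Pi.single j t) :=
      hf.continuous.comp (continuous_single (A := fun _ => ℝ) j)
    have hclosed : IsClosed {t : ℝ | 0 ≤ t ∧ f (Pi.single j t) ≤ α} :=
      (isClosed_le continuous_const continuous_id).inter (isClosed_le hcont continuous_const)
    have hsub : {t : ℝ | 0 ≤ t ∧ f (Pi.single j t) ≤ α}
        ⊆ Set.Icc 0 (max 1 (α / f (Pi.single j 1))) := by
      rintro t ⟨ht0, ht⟩
      refine ⟨ht0, ?_⟩
      rcases le_total t 1 with h | h
      · exact h.trans (le_max_left _ _)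
      · refine le_trans ?_ (le_max_right _ _)
        rw [le_div_iff₀ hj]
        have := hf.mul_le_map_smul h h1
        rw [hsmul] at this
        exact this.trans ht
    have hcompact := isCompact_Icc.of_isClosed_subset hclosed hsub
    have hmem : min 1 (α / f (Pi.single j 1)) ∈ {t : ℝ | 0 ≤ t ∧ f (Pi.single j t) ≤ α} := by
      have h0 : 0 ≤ min 1 (α / f (Pi.single j 1)) := le_min zero_le_one (by positivity)
      refine ⟨h0, ?_⟩
      have := hf.map_smul_le_of_le_one h0 (min_le_left _ _) h1
      rw [hsmul] at this
      refine this.trans ?_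
      rw [← le_div_iff₀ hj]
      exact min_le_right _ _
    obtain ⟨b, hb1, hb2⟩ := hcompact.exists_isGreatest ⟨_, hmem⟩
    exact ⟨b, lt_of_lt_of_le (lt_min zero_lt_one (by positivity)) (hb2 hmem), hb1.2,
      fun t ht0 ht => hb2 ⟨ht0, ht⟩⟩
  choose! b hb0 hbα hbmax using hb
  set S := Finset.univ.filter fun j : Fin n => 0 < f (Pi.single j 1) with hS
  -- A convex combination of the extreme points `Pi.single j (b j)`, the remaining weight going to
  -- the origin, so its cost is at most `α`.
  set u : Fin n → ℝ := ∑ j ∈ S, (1 / M : ℝ) • Pi.single j (b j) with hu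
  have huval : ∀ j, 0 < f (Pi.single j 1) → u j = b j / M := by
    intro j hj
    rw [hu, Finset.sum_apply, Finset.sum_eq_single j]
    · simp; ring
    · intro i _ hi; simp [hi.symm]
    · intro h; exact absurd (by simpa [hS] using hj) h
  have hu0 : 0 ≤ u := Finset.sum_nonneg fun j hj => smul_nonneg (by positivity)
    (Pi.single_nonneg.2 (hb0 j (Finset.mem_filter.1 hj).2).le)
  have hfu : f u ≤ α := by
    have hcM : (S.card : ℝ) * (1 / M) ≤ 1 := by
      rw [mul_one_div, div_le_one hM']
      exact_mod_cast hcard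
    have h := hf.convexOn.map_add_sum_le (t := S) (w := fun _ => (1 / M : ℝ))
      (p := fun j => Pi.single j (b j)) (v := 1 - S.card * (1 / M)) (q := 0)
      (fun _ _ => by positivity) (by simp)
      (fun j hj => single_nonneg (hb0 j (Finset.mem_filter.1 hj).2).le)
      (sub_nonneg.2 hcM) (fun _ => le_rfl)
    rw [hf.map_zero, smul_zero, zero_add, smul_zero, zero_add] at h
    refine h.trans ((Finset.sum_le_sum fun j hj => mul_le_mul_of_nonneg_left
      (hbα j (Finset.mem_filter.1 hj).2) (by positivity : (0 : ℝ) ≤ 1 / M)).trans ?_)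
    rw [Finset.sum_const, nsmul_eq_mul, ← mul_assoc]
    exact mul_le_of_le_one_left hα.le hcM
  -- Free coordinates get the value 1 only to be positive, so that logarithms make sense.
  refine ⟨fun j => if 0 < f (Pi.single j 1) then c * u j else 1, fun j => ?_, ?_, ?_⟩
  · dsimp only
    split_ifs with hj
    · rw [huval j hj]
      have := hb0 j hj
      positivity
    · exact one_pos
  · refine (hf.map_le_of_le_on_costly (x := c • u) (smul_nonneg (by linarith) hu0) (fun j => ?_)
      fun j hj => ?_).trans ((hf.map_smul_le c u hc hu0).trans
        (mul_le_mul_of_nonneg_left hfu (by positivity)))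
    · dsimp only
      split_ifs
      · exact mul_nonneg (by linarith) (hu0 j)
      · exact zero_le_one
    · simp [hj]
  · intro s hs hsα j hj
    simp only [hj, if_true]
    rw [huval j hj, mul_div_assoc]
    have := hbmax j hj (s j) (hs j)
      ((hf.mono (Pi.single_nonneg.2 (hs j)) (single_le hs j)).trans hsα)
    gcongr

end IsMonotoneGradientCost

end OnlineCovering

/-! ### Multiplicative updates and the entropy charge -/

namespace OnlineCovering

variable {n : ℕ}

/-- The cost increase from `x` to `y` is paid for by the entropy that every comparator `s ∈ S`
gains, weighted by the gradient at `y`. -/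
def Charged (f : (Fin n → ℝ) → ℝ) (g : Fin n → (Fin n → ℝ) → ℝ) (S : Set (Fin n → ℝ))
    (x y : Fin n → ℝ) : Prop :=
  x ≤ y ∧ ∀ s ∈ S, f y - f x ≤ 6 * ∑ j, g j y * (s j * Real.log (y j / x j))

variable {τ : ℕ} {f : (Fin n → ℝ) → ℝ} {g : Fin n → (Fin n → ℝ) → ℝ} {S : Set (Fin n → ℝ)}

theorem Charged.subset {T : Set (Fin n → ℝ)} {x y : Fin n → ℝ} (h : Charged f g T x y)
    (hST : S ⊆ T) : Charged f g S x y :=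
  ⟨h.1, fun s hs => h.2 s (hST hs)⟩

namespace IsMonotoneGradientCost

theorem charged_of_le (hf : IsMonotoneGradientCost τ f g) (hS : ∀ s ∈ S, 0 ≤ s)
    {x y : Fin n → ℝ} (hx : ∀ j, 0 < x j) (hxy : x ≤ y) (h : f y ≤ f x) : Charged f g S x y := by
  refine ⟨hxy, fun s hs => (sub_nonpos.2 h).trans (mul_nonneg (by norm_num) ?_)⟩
  exact Finset.sum_nonneg fun j _ => mul_nonneg
    (hf.grad_nonneg j y ((show 0 ≤ x from fun j => (hx j).le).trans hxy))
    (mul_nonneg (hS s hs j) (Real.log_nonneg ((one_le_div (hx j)).2 (hxy j))))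

/-- The charge of the first stretch is weighted by the gradient at `y`; monotonicity raises it to
the gradient at `z`, after which the logarithms add. -/
theorem charged_trans (hf : IsMonotoneGradientCost τ f g) (hS : ∀ s ∈ S, 0 ≤ s)
    {x y z : Fin n → ℝ} (hx : ∀ j, 0 < x j) (hxy : Charged f g S x y)
    (hyz : Charged f g S y z) : Charged f g S x z := by
  refine ⟨hxy.1.trans hyz.1, fun s hs => ?_⟩
  have hx0 : 0 ≤ x := fun j => (hx j).le
  have h1 := hxy.2 s hs
  have h2 := hyz.2 s hs
  have h3 : ∑ j, g j y * (s j * Real.log (y j / x j))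
      ≤ ∑ j, g j z * (s j * Real.log (y j / x j)) :=
    Finset.sum_le_sum fun j _ => mul_le_mul_of_nonneg_right
      (hf.grad_mono j y z (hx0.trans hxy.1) hyz.1)
      (mul_nonneg (hS s hs j) (Real.log_nonneg ((one_le_div (hx j)).2 (hxy.1 j))))
  have h4 : ∑ j, g j z * (s j * Real.log (z j / x j))
      = ∑ j, g j z * (s j * Real.log (y j / x j)) + ∑ j, g j z * (s j * Real.log (z j / y j)) := by
    rw [← Finset.sum_add_distrib]
    refine Finset.sum_congr rfl fun j _ => ?_
    have hy : 0 < y j := (hx j).trans_le (hxy.1 j)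
    have hz : 0 < z j := hy.trans_le (hyz.1 j)
    rw [Real.log_div hz.ne' (hx j).ne', Real.log_div hy.ne' (hx j).ne',
      Real.log_div hz.ne' hy.ne']
    ring
  rw [h4]
  linarith

/-- One multiplicative update towards satisfying the request `r`. -/
theorem exists_charged_step (hf : IsMonotoneGradientCost τ f g) (hτ : 1 ≤ τ) {r : Request n}
    (hr : ∀ j, 0 < r.a j → 0 < f (Pi.single j 1)) {x : Fin n → ℝ} (hx : ∀ j, 0 < x j)
    (hrx : ¬ r.SatisfiedBy x) :
    ∃ y, Charged f g {s | 0 ≤ s ∧ r.SatisfiedBy s} x y ∧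
      ∑ j with 0 < r.a j, Real.log (x j) + Real.log (1 + 1 / τ)
        ≤ ∑ j with 0 < r.a j, Real.log (y j) := by
  have hx0 : 0 ≤ x := fun j => (hx j).le
  have hτ0 : (0 : ℝ) < τ := by exact_mod_cast hτ
  have hτ1 : (1 : ℝ) ≤ τ := by exact_mod_cast hτ
  have hg : ∀ j, 0 < r.a j → 0 < g j x := fun j hj => hf.grad_pos (hr j hj) hx0 (hx j)
  obtain ⟨i, hi⟩ := r.satisfiable
  obtain ⟨k, hk, hmin⟩ := Finset.exists_min_image (Finset.univ.filter fun j => 0 < r.a j)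
    (fun j => g j x / (τ * r.a j)) ⟨i, by simpa using hi⟩
  replace hk : 0 < r.a k := (Finset.mem_filter.1 hk).2
  -- The largest step size for which all relative increments `u j` are at most `1 / τ`, with
  -- equality at `k`. Hence each gradient coordinate grows by at most `(1 + 1 / τ) ^ τ ≤ e ≤ 3`.
  set δ := g k x / (τ * r.a k) with hδ
  have hδ0 : 0 < δ := div_pos (hg k hk) (by positivity)
  set u : Fin n → ℝ := fun j => δ * r.a j / g j x with hu
  have hzero : ∀ j, ¬ 0 < r.a j → r.a j = 0 := fun j hj => le_antisymm (not_lt.1 hj) (r.nonneg j)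
  have hu0 : ∀ j, 0 ≤ u j := fun j =>
    div_nonneg (mul_nonneg hδ0.le (r.nonneg j)) (hf.grad_nonneg j x hx0)
  have hu1 : ∀ j, u j ≤ 1 / τ := by
    intro j
    by_cases hj : 0 < r.a j
    · have h := hmin j (by simpa using hj)
      rw [le_div_iff₀ (by positivity)] at h
      rw [hu, div_le_div_iff₀ (hg j hj) hτ0]
      linarith
    · simp [hu, hzero j hj]
  have huk : u k = 1 / τ := by
    have := (hg k hk).ne'
    simp only [hu, hδ]
    field_simp
  have hgu : ∀ j, g j x * u j = δ * r.a j := by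
    intro j
    by_cases hj : 0 < r.a j
    · simp only [hu]
      rw [mul_div_cancel₀ _ (hg j hj).ne']
    · simp [hu, hzero j hj]
  have hlogu : ∀ j, u j / 2 ≤ Real.log (1 + u j) := by
    intro j
    have h0 := hu0 j
    have h1 : u j ≤ 1 := (hu1 j).trans (by rw [div_le_one hτ0]; exact hτ1)
    have h := Real.one_sub_inv_le_log_of_pos (show 0 < 1 + u j by linarith)
    refine le_trans ?_ h
    rw [show 1 - (1 + u j)⁻¹ = u j / (1 + u j) by field_simp; ring]
    exact div_le_div_of_nonneg_left h0 (by linarith) (by linarith)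
  have hxy : x ≤ fun j => x j * (1 + u j) := fun j =>
    le_mul_of_one_le_right (hx j).le (by linarith [hu0 j])
  have hg3 : ∀ j, g j (fun j => x j * (1 + u j)) ≤ 3 * g j x := by
    intro j
    have hle : (fun j => x j * (1 + u j)) ≤ (1 + 1 / τ : ℝ) • x := fun i => by
      simp only [Pi.smul_apply, smul_eq_mul]
      rw [mul_comm]
      exact mul_le_mul_of_nonneg_right (by linarith [hu1 i]) (hx i).le
    refine (hf.grad_mono j _ _ (hx0.trans hxy) hle).trans ((hf.grad_smul_le j _ x
      (le_add_of_nonneg_right (by positivity)) hx0).trans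
      (mul_le_mul_of_nonneg_right ?_ (hf.grad_nonneg j x hx0)))
    calc (1 + 1 / τ : ℝ) ^ τ ≤ Real.exp (1 / τ) ^ τ :=
          pow_le_pow_left₀ (by positivity) (by linarith [Real.add_one_le_exp (1 / τ : ℝ)]) _
      _ = Real.exp 1 := by rw [← Real.exp_nat_mul, mul_one_div_cancel hτ0.ne']
      _ ≤ 3 := by linarith [Real.exp_one_lt_d9]
  refine ⟨fun j => x j * (1 + u j), ⟨hxy, fun s hs => ?_⟩, ?_⟩
  -- Since the request is still unsatisfied at `x`, the tangent inequality at the new point bounds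
  -- the cost by `3 δ`. Any `s` satisfying the request gains at least `δ / 2`, whence the factor 6
  -- in `Charged`.
  · have hcost : f (fun j => x j * (1 + u j)) - f x ≤ 3 * δ := by
      have h := hf.add_grad_le (fun j => x j * (1 + u j)) x (hx0.trans hxy) hx0
      have h1 : ∑ j, g j (fun j => x j * (1 + u j)) * (x j * (1 + u j) - x j)
          ≤ ∑ j, 3 * δ * (r.a j * x j) := Finset.sum_le_sum fun j _ => by
        calc g j (fun j => x j * (1 + u j)) * (x j * (1 + u j) - x j)
            = g j (fun j => x j * (1 + u j)) * (x j * u j) := by ring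
          _ ≤ 3 * g j x * (x j * u j) :=
              mul_le_mul_of_nonneg_right (hg3 j) (mul_nonneg (hx j).le (hu0 j))
          _ = 3 * (g j x * u j) * x j := by ring
          _ = 3 * δ * (r.a j * x j) := by rw [hgu]; ring
      rw [← Finset.mul_sum] at h1
      have h2 : ∑ j, g j (fun j => x j * (1 + u j)) * (x j - x j * (1 + u j))
          = -∑ j, g j (fun j => x j * (1 + u j)) * (x j * (1 + u j) - x j) := by
        rw [← Finset.sum_neg_distrib]
        exact Finset.sum_congr rfl fun j _ => by ring
      have h3 : ∑ j, r.a j * x j ≤ 1 := (not_le.1 hrx).le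
      have h4 : 3 * δ * ∑ j, r.a j * x j ≤ 3 * δ * 1 :=
        mul_le_mul_of_nonneg_left h3 (by positivity)
      linarith
    have hgain : δ / 2 ≤ ∑ j, g j (fun j => x j * (1 + u j)) *
        (s j * Real.log (x j * (1 + u j) / x j)) := by
      have hsat : (1 : ℝ) ≤ ∑ j, r.a j * s j := hs.2
      calc δ / 2 ≤ δ / 2 * ∑ j, r.a j * s j := le_mul_of_one_le_right (by positivity) hsat
        _ = ∑ j, δ / 2 * (r.a j * s j) := Finset.mul_sum _ _ _
        _ ≤ _ := Finset.sum_le_sum fun j _ => ?_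
      rw [mul_div_cancel_left₀ _ (hx j).ne']
      calc δ / 2 * (r.a j * s j) = (δ * r.a j) * s j / 2 := by ring
        _ = g j x * (s j * (u j / 2)) := by rw [← hgu]; ring
        _ ≤ g j (fun j => x j * (1 + u j)) * (s j * Real.log (1 + u j)) :=
            mul_le_mul (hf.grad_mono j _ _ hx0 hxy)
              (mul_le_mul_of_nonneg_left (hlogu j) (hs.1 j))
              (mul_nonneg (hs.1 j) (by linarith [hu0 j]))
              (hf.grad_nonneg j _ (hx0.trans hxy))
    linarith
  · have hlog : ∀ j, Real.log (x j * (1 + u j)) = Real.log (x j) + Real.log (1 + u j) :=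
      fun j => Real.log_mul (hx j).ne' (by linarith [hu0 j])
    simp only [hlog, Finset.sum_add_distrib]
    rw [← huk]
    gcongr
    exact Finset.single_le_sum (f := fun j => Real.log (1 + u j))
      (fun j _ => Real.log_nonneg (by linarith [hu0 j])) (by simpa using hk)

/-- Each update raises the sum of `log (x j)` over the request's support by at least the fixed
amount `log (1 + 1 / τ)`, while an unsatisfied request forces `r.a j * x j ≤ 1`. So finitely many
updates suffice. -/
theorem exists_charged (hf : IsMonotoneGradientCost τ f g) (hτ : 1 ≤ τ) {r : Request n}
    (hr : ∀ j, 0 < r.a j → 0 < f (Pi.single j 1)) {x : Fin n → ℝ} (hx : ∀ j, 0 < x j) :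
    ∃ y, Charged f g {s | 0 ≤ s ∧ r.SatisfiedBy s} x y ∧ r.SatisfiedBy y := by
  by_contra! hcon
  have hτ0 : (0 : ℝ) < τ := by exact_mod_cast hτ
  have hiter : ∀ N : ℕ, ∃ y, Charged f g {s | 0 ≤ s ∧ r.SatisfiedBy s} x y ∧
      ∑ j with 0 < r.a j, Real.log (x j) + N * Real.log (1 + 1 / τ)
        ≤ ∑ j with 0 < r.a j, Real.log (y j) := by
    intro N
    induction N with
    | zero => exact ⟨x, hf.charged_of_le (fun s hs => hs.1) hx le_rfl le_rfl, by simp⟩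
    | succ N ih =>
      obtain ⟨y, hy, hlog⟩ := ih
      obtain ⟨z, hz, hlog'⟩ := hf.exists_charged_step hτ hr
        (fun j => (hx j).trans_le (hy.1 j)) (hcon y hy)
      refine ⟨z, hf.charged_trans (fun s hs => hs.1) hx hy hz, ?_⟩
      push_cast
      linarith
  have hlog0 : 0 < Real.log (1 + 1 / τ) :=
    Real.log_pos (lt_add_of_pos_right _ (by positivity))
  obtain ⟨N, hN⟩ := exists_nat_gt
    ((∑ j with 0 < r.a j, -Real.log (r.a j) - ∑ j with 0 < r.a j, Real.log (x j))
      / Real.log (1 + 1 / τ))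
  obtain ⟨y, hy, hlog⟩ := hiter N
  have hy0 : ∀ j, 0 < y j := fun j => (hx j).trans_le (hy.1 j)
  rw [div_lt_iff₀ hlog0] at hN
  have : ∑ j with 0 < r.a j, Real.log (y j) ≤ ∑ j with 0 < r.a j, -Real.log (r.a j) := by
    refine Finset.sum_le_sum fun j hj => ?_
    have hj' : 0 < r.a j := (Finset.mem_filter.1 hj).2
    have h1 : r.a j * y j ≤ 1 := by
      by_contra! h
      exact hcon y hy (Request.satisfiedBy_of_coord (fun j => (hy0 j).le) h.le)
    have := Real.log_nonpos (by have := hy0 j; positivity) h1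
    rw [Real.log_mul hj'.ne' (hy0 j).ne'] at this
    linarith
  linarith

/-- The cost stays bounded as long as a cheap comparator exists. -/
theorem le_of_charged (hf : IsMonotoneGradientCost τ f g) (hτ : 1 ≤ τ) {M : ℕ} (hM : 2 ≤ M)
    {α : ℝ} {x z s : Fin n → ℝ} (hz : ∀ j, 0 < z j) (hzx : Charged f g {s} z x) (hs : 0 ≤ s)
    (hsα : f s ≤ α)
    (hfloor : ∀ j, 0 < f (Pi.single j 1) → 24 * τ * s j / M ≤ z j) :
    f x ≤ 2 * f z + 2 * ((24 * τ * Real.log M) ^ τ * α) := by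
  have hτ1 : (1 : ℝ) ≤ τ := by exact_mod_cast hτ
  have hM0 : (0 : ℝ) < M := by positivity
  have hL : 1 / 2 ≤ Real.log M := by
    have h2 : Real.log 2 ≤ Real.log M := Real.log_le_log two_pos (by exact_mod_cast hM)
    linarith [Real.log_two_gt_d9]
  set L := Real.log M
  have hx : ∀ j, 0 < x j := fun j => (hz j).trans_le (hzx.1 j)
  have hx0 : 0 ≤ x := fun j => (hx j).le
  have hterm : ∀ j, g j x * (s j * Real.log (x j / z j))
      ≤ L * (g j x * s j) + (1 / (24 * τ)) * (g j x * x j) := by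
    intro j
    by_cases hj : 0 < f (Pi.single j 1)
    · rw [show L * (g j x * s j) + (1 / (24 * τ)) * (g j x * x j)
        = g j x * (s j * L + 1 / (24 * τ) * x j) by ring]
      refine mul_le_mul_of_nonneg_left ?_ (hf.grad_nonneg j x hx0)
      rcases (hs j).eq_or_lt with h0 | hsj
      · have h0' : s j = 0 := h0.symm
        rw [h0', zero_mul, zero_mul, zero_add]
        exact mul_nonneg (by positivity) (hx j).le
      · have hsj' : 0 < s j := hsj
        have hxj := hx j
        have hle : x j / z j ≤ M * (x j / (24 * τ * s j)) := by
          have := hfloor j hj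
          calc x j / z j ≤ x j / (24 * τ * s j / M) :=
                div_le_div_of_nonneg_left hxj.le (by positivity) this
            _ = _ := by field_simp
        -- Uses `log t ≤ t - 1` with `t = x j / (24 τ s j)`.
        have hlog : Real.log (x j / z j) ≤ L + x j / (24 * τ * s j) := by
          refine (Real.log_le_log (div_pos hxj (hz j)) hle).trans ?_
          rw [Real.log_mul hM0.ne' (by positivity)]
          have := Real.log_le_sub_one_of_pos (show 0 < x j / (24 * τ * s j) by positivity)
          linarith
        calc s j * Real.log (x j / z j) ≤ s j * (L + x j / (24 * τ * s j)) :=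
              mul_le_mul_of_nonneg_left hlog hsj'.le
          _ = s j * L + 1 / (24 * τ) * x j := by field_simp
    · simp [hf.grad_eq_zero hj hx0]
  have hsum := hzx.2 s rfl
  have h1 : ∑ j, g j x * (s j * Real.log (x j / z j))
      ≤ L * ∑ j, g j x * s j + 1 / (24 * τ) * ∑ j, g j x * x j := by
    rw [Finset.mul_sum, Finset.mul_sum, ← Finset.sum_add_distrib]
    exact Finset.sum_le_sum fun j _ => hterm j
  have heuler := hf.sum_grad_mul_le x hx0
  have hfx := hf.nonneg hx0
  have h2 : 1 / (24 * τ) * ∑ j, g j x * x j ≤ f x / 24 := by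
    calc 1 / (24 * τ) * ∑ j, g j x * x j ≤ 1 / (24 * τ) * (τ * f x) :=
          mul_le_mul_of_nonneg_left heuler (by positivity)
      _ = f x / 24 := by field_simp
  have hc : 1 ≤ 24 * τ * L := by nlinarith
  -- The tangent inequality at `x` towards the comparator scaled by `24 τ L`: after division, `f x`
  -- appears in `L ⟨g x, s⟩` with coefficient only `1 / 24`. With the `f x / 24` above and the
  -- factor 6, half of `f x` remains to be absorbed.
  have h3 : (24 * τ * L) * ∑ j, g j x * s j ≤ (24 * τ * L) ^ τ * α + τ * f x := by
    have h := hf.add_grad_le x ((24 * τ * L) • s) hx0 (smul_nonneg (by linarith) hs)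
    have hscale := (hf.map_smul_le _ s hc hs).trans
      (mul_le_mul_of_nonneg_left hsα (by positivity))
    have hexp : ∑ j, g j x * (((24 * τ * L) • s) j - x j)
        = (24 * τ * L) * ∑ j, g j x * s j - ∑ j, g j x * x j := by
      rw [Finset.mul_sum, ← Finset.sum_sub_distrib]
      refine Finset.sum_congr rfl fun j _ => ?_
      simp only [Pi.smul_apply, smul_eq_mul]
      ring
    rw [hexp] at h
    linarith
  have hα : 0 ≤ (24 * τ * L) ^ τ * α :=
    mul_nonneg (by positivity) ((hf.nonneg hs).trans hsα)
  have h4 : L * ∑ j, g j x * s j ≤ (24 * τ * L) ^ τ * α / 24 + f x / 24 := by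
    have h5 : τ * (24 * (L * ∑ j, g j x * s j)) ≤ τ * ((24 * τ * L) ^ τ * α + f x) := by
      have : (24 * τ * L) ^ τ * α ≤ τ * ((24 * τ * L) ^ τ * α) := le_mul_of_one_le_left hα hτ1
      linarith
    have := le_of_mul_le_mul_left h5 (by linarith)
    linarith
  linarith

end IsMonotoneGradientCost

end OnlineCovering

/-! ### Guessing the optimum in phases -/

namespace OnlineCovering

variable {n : ℕ} {τ : ℕ} {f : (Fin n → ℝ) → ℝ} {g : Fin n → (Fin n → ℝ) → ℝ}

/-- `x` is reached from a cheap starting point `z` by charged updates, where the optimum for the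
requests `σ` is known up to the factor `B` through the budget `α`. -/
def InPhase (f : (Fin n → ℝ) → ℝ) (g : Fin n → (Fin n → ℝ) → ℝ) (τ M : ℕ) (A B α : ℝ)
    (σ : List (Request n)) (x : Fin n → ℝ) : Prop :=
  (∃ s, Feasible σ s ∧ f s ≤ α) ∧ (∀ s, Feasible σ s → α ≤ B * f s) ∧
    ∃ z : Fin n → ℝ, (∀ j, 0 < z j) ∧ f z ≤ A * α ∧
      (∀ s, 0 ≤ s → f s ≤ α → ∀ j, 0 < f (Pi.single j 1) → 24 * τ * s j / M ≤ z j) ∧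
      Charged f g {s | Feasible σ s} z x

theorem InPhase.pos {M : ℕ} {A B α : ℝ} {σ : List (Request n)} {x : Fin n → ℝ}
    (h : InPhase f g τ M A B α σ x) (j : Fin n) : 0 < x j := by
  obtain ⟨-, -, z, hz, -, -, hzx⟩ := h
  exact (hz j).trans_le (hzx.1 j)

namespace IsMonotoneGradientCost

theorem le_of_inPhase (hf : IsMonotoneGradientCost τ f g) (hτ : 1 ≤ τ) {M : ℕ} (hM : 2 ≤ M)
    {A B α : ℝ} {σ : List (Request n)} {x : Fin n → ℝ} (h : InPhase f g τ M A B α σ x) :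
    f x ≤ (2 * A + 2 * (24 * τ * Real.log M) ^ τ) * α := by
  obtain ⟨⟨s, hs, hsα⟩, -, z, hz, hfz, hfloor, hzx⟩ := h
  have := hf.le_of_charged hτ hM hz (hzx.subset (Set.singleton_subset_iff.2 hs)) hs.1 hsα
    (hfloor s hs.1 hsα)
  linarith

/-- Extending a phase by a charged update. -/
theorem inPhase_concat (hf : IsMonotoneGradientCost τ f g) {M : ℕ} {A B α : ℝ}
    {σ : List (Request n)} {x y : Fin n → ℝ} {r : Request n} (h : InPhase f g τ M A B α σ x)
    (hs : ∃ s, Feasible (σ ++ [r]) s ∧ f s ≤ α)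
    (hxy : Charged f g {s | Feasible (σ ++ [r]) s} x y) :
    InPhase f g τ M A B α (σ ++ [r]) y := by
  obtain ⟨-, hB, z, hz, hfz, hfloor, hzx⟩ := h
  exact ⟨hs, fun s hs => hB s hs.of_concat, z, hz, hfz, hfloor,
    hf.charged_trans (fun s hs => hs.1) hz (hzx.subset fun s hs => hs.of_concat) hxy⟩

/-- Some coordinate must contribute at least `1 / n` to the request, and each such contribution has
positive cost. This keeps the optimum away from 0, so the next budget is positive. -/
theorem exists_pos_le (hf : IsMonotoneGradientCost τ f g) {r : Request n}
    (hr : ∀ j, 0 < r.a j → 0 < f (Pi.single j 1)) :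
    ∃ ε, 0 < ε ∧ ∀ s, 0 ≤ s → r.SatisfiedBy s → ε ≤ f s := by
  obtain ⟨i, hi⟩ := r.satisfiable
  have hn : (0 : ℝ) < n := by exact_mod_cast i.pos
  obtain ⟨k, hk, hmin⟩ := Finset.exists_min_image (Finset.univ.filter fun j => 0 < r.a j)
    (fun j => f (Pi.single j (1 / (n * r.a j)))) ⟨i, by simpa using hi⟩
  replace hk : 0 < r.a k := (Finset.mem_filter.1 hk).2
  refine ⟨_, hf.map_single_pos (hr k hk) (t := 1 / (n * r.a k)) (by positivity),
    fun s hs hsat => ?_⟩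
  obtain ⟨j, -, hj⟩ := Finset.exists_le_of_sum_le (s := Finset.univ) (f := fun _ => 1 / (n : ℝ))
    (g := fun j => r.a j * s j) ⟨i, Finset.mem_univ i⟩ (by
      rw [Finset.sum_const, Finset.card_univ, Fintype.card_fin, nsmul_eq_mul,
        mul_one_div_cancel hn.ne']
      exact hsat)
  have hj0 : 0 < r.a j := pos_of_mul_pos_left ((by positivity : 0 < 1 / (n : ℝ)).trans_le hj) (hs j)
  refine (hmin j (by simpa using hj0)).trans
    ((hf.mono (single_nonneg (by positivity)) ?_).trans
      (hf.mono (single_nonneg (hs j)) (single_le hs j)))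
  refine Pi.single_le_single.2 ?_
  rw [← div_div, div_le_iff₀ hj0, mul_comm]
  exact hj

/-- Starting a new phase. -/
theorem exists_inPhase (hf : IsMonotoneGradientCost τ f g) (hτ : 1 ≤ τ) {M : ℕ} (hM : 2 ≤ M)
    (hcard : (Finset.univ.filter fun j : Fin n => 0 < f (Pi.single j 1)).card ≤ M)
    {R α : ℝ} {σ : List (Request n)} {r : Request n}
    (hr : ∀ j, 0 < r.a j → 0 < f (Pi.single j 1)) {x : Fin n → ℝ} (hx : Feasible σ x)
    (hR : 0 ≤ R) (hfx : f x ≤ R * α) (hopt : ∀ s, Feasible (σ ++ [r]) s → α ≤ f s) :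
    ∃ y β, InPhase f g τ M (R / 4 + (48 * τ) ^ τ) (4 * 2 ^ τ) β (σ ++ [r]) y ∧
      r.SatisfiedBy y ∧ x ≤ y := by
  have hτ1 : (1 : ℝ) ≤ τ := by exact_mod_cast hτ
  obtain ⟨j, hj⟩ := r.satisfiable
  obtain ⟨s₀, hs₀, hs₀r, -⟩ := Request.exists_raise hj hx.1
  obtain ⟨ε, hε, hεle⟩ := hf.exists_pos_le hr
  have hne : (f '' {s | Feasible (σ ++ [r]) s}).Nonempty :=
    ⟨_, s₀, hx.concat hs₀ hs₀r, rfl⟩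
  have hlb : ε ∈ lowerBounds (f '' {s | Feasible (σ ++ [r]) s}) := by
    rintro _ ⟨s, hs, rfl⟩
    exact hεle s hs.1 hs.satisfiedBy_last
  have hglb := isGLB_csInf hne ⟨ε, hlb⟩
  set ω := sInf (f '' {s | Feasible (σ ++ [r]) s})
  have hω : 0 < ω := hε.trans_le (hglb.2 hlb)
  have hαω : α ≤ ω := hglb.2 (by rintro _ ⟨s, hs, rfl⟩; exact hopt s hs)
  -- The new budget strictly exceeds the infimum `ω`, so an actual feasible point fits in it even if
  -- `ω` is not attained. Its factor `2 ^ τ` cancels the loss of `map_add_le`, leaving only `R / 4`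
  -- from the old cost.
  have hB : (4 : ℝ) ≤ 4 * 2 ^ τ := le_mul_of_one_le_right (by norm_num) (one_le_pow₀ one_le_two)
  have hωB : ω < 4 * 2 ^ τ * ω := by nlinarith
  obtain ⟨_, ⟨s₁, hs₁, rfl⟩, -, hs₁lt⟩ := hglb.exists_between hωB
  have hβ : 0 < 4 * 2 ^ τ * ω := by positivity
  obtain ⟨v, hv0, hfv, hvfloor⟩ :=
    hf.exists_floor (by omega) hcard (c := 24 * τ) (by linarith) hβ
  have hvnn : 0 ≤ v := fun j => (hv0 j).le
  have hz0 : ∀ j, 0 < (x + v) j := fun j => add_pos_of_nonneg_of_pos (hx.1 j) (hv0 j)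
  obtain ⟨y, hy, hyr⟩ := hf.exists_charged hτ hr hz0
  refine ⟨y, 4 * 2 ^ τ * ω, ⟨⟨s₁, hs₁, hs₁lt.le⟩, fun s hs => ?_, x + v, hz0, ?_,
    fun s hs hsβ j hj => ?_, hy.subset fun s hs => ⟨hs.1, hs.satisfiedBy_last⟩⟩, hyr,
    (le_add_of_nonneg_right hvnn).trans hy.1⟩
  · exact mul_le_mul_of_nonneg_left (hglb.1 ⟨s, hs, rfl⟩) (by positivity)
  · have hfx' : f x ≤ R * ω := hfx.trans (mul_le_mul_of_nonneg_left hαω hR)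
    refine (hf.map_add_le hx.1 hvnn).trans
      ((mul_le_mul_of_nonneg_left (add_le_add hfx' hfv) (by positivity)).trans (le_of_eq ?_))
    rw [show (48 * τ : ℝ) = 2 * (24 * τ) by ring, mul_pow 2 (24 * τ : ℝ)]
    ring
  · exact (hvfloor s hs hsβ j hj).trans (le_add_of_nonneg_left (hx.1 j))

theorem exists_onlineAlgorithm (hf : IsMonotoneGradientCost τ f g) (hτ : 1 ≤ τ) {M : ℕ}
    (hM : 2 ≤ M)
    (hcard : (Finset.univ.filter fun j : Fin n => 0 < f (Pi.single j 1)).card ≤ M) :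
    ∃ alg : OnlineAlgorithm n, alg.IsCompetitive f ((6144 * τ * Real.log M) ^ τ) := by
  have hτ1 : (1 : ℝ) ≤ τ := by exact_mod_cast hτ
  have hL : 1 / 2 ≤ Real.log M := by
    have h2 : Real.log 2 ≤ Real.log M := Real.log_le_log two_pos (by exact_mod_cast hM)
    linarith [Real.log_two_gt_d9]
  -- The fixed point of `R = 2 * A + 2 * (24 τ log M) ^ τ` with `A = R / 4 + (48 τ) ^ τ`: the
  -- per-phase bound reproduces itself, so no sum over phases is needed.
  set R : ℝ := 4 * ((48 * τ) ^ τ + (24 * τ * Real.log M) ^ τ) with hR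
  have hR0 : 0 ≤ R := by positivity
  set A : ℝ := R / 4 + (48 * τ) ^ τ with hA
  have hAR : 2 * A + 2 * (24 * τ * Real.log M) ^ τ = R := by rw [hA, hR]; ring
  have hratio : R * (4 * 2 ^ τ) ≤ (6144 * τ * Real.log M) ^ τ := by
    have h1 : (48 * τ : ℝ) ^ τ ≤ (96 * τ * Real.log M) ^ τ :=
      pow_le_pow_left₀ (by positivity) (by nlinarith) _
    have h2 : (24 * τ * Real.log M : ℝ) ^ τ ≤ (96 * τ * Real.log M) ^ τ :=
      pow_le_pow_left₀ (by positivity) (by nlinarith) _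
    have h3 : (32 : ℝ) ≤ 32 ^ τ := le_self_pow₀ (by norm_num) (by omega)
    calc R * (4 * 2 ^ τ)
        ≤ 4 * ((96 * τ * Real.log M) ^ τ + (96 * τ * Real.log M) ^ τ) * (4 * 2 ^ τ) := by
          rw [hR]; gcongr
      _ = 32 * (2 ^ τ * (96 * τ * Real.log M) ^ τ) := by ring
      _ ≤ 32 ^ τ * (2 ^ τ * (96 * τ * Real.log M) ^ τ) := by gcongr
      _ = (6144 * τ * Real.log M) ^ τ := by rw [← mul_pow, ← mul_pow]; ring
  -- Before the first phase only free coordinates have been raised, so the cost is 0.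
  obtain ⟨alg, halg⟩ := exists_onlineAlgorithm_of_invariant
    (fun σ x => Feasible σ x ∧ ((∀ j, 0 < f (Pi.single j 1) → x j = 0) ∨
      ∃ α, InPhase f g τ M A (4 * 2 ^ τ) α σ x)) (fun _ _ h => h.1)
    ⟨0, ⟨fun _ => le_rfl, by simp⟩, Or.inl fun _ _ => rfl⟩ (by
      rintro σ x r ⟨hx, hinv⟩
      by_cases hr : ∀ j, 0 < r.a j → 0 < f (Pi.single j 1)
      · have hnew : ∀ α, f x ≤ R * α → (∀ s, Feasible (σ ++ [r]) s → α ≤ f s) →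
            ∃ y, (Feasible (σ ++ [r]) y ∧ ((∀ j, 0 < f (Pi.single j 1) → y j = 0) ∨
              ∃ α, InPhase f g τ M A (4 * 2 ^ τ) α (σ ++ [r]) y)) ∧ x ≤ y := by
          intro α hfx hopt
          obtain ⟨y, β, hy, hyr, hxy⟩ := hf.exists_inPhase hτ hM hcard hr hx hR0 hfx hopt
          exact ⟨y, ⟨hx.concat hxy hyr, Or.inr ⟨β, hy⟩⟩, hxy⟩
        rcases hinv with hzero | ⟨α, hα⟩
        · refine hnew 0 ?_ fun s hs => hf.nonneg hs.1
          rw [mul_zero, ← hf.map_zero]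
          exact hf.map_le_of_le_on_costly le_rfl hx.1 fun j hj => (hzero j hj).le
        · by_cases hs : ∃ s, Feasible (σ ++ [r]) s ∧ f s ≤ α
          · obtain ⟨y, hy, hyr⟩ := hf.exists_charged hτ hr hα.pos
            exact ⟨y, ⟨hx.concat hy.1 hyr, Or.inr ⟨α, hf.inPhase_concat hα hs
              (hy.subset fun s hs => ⟨hs.1, hs.satisfiedBy_last⟩)⟩⟩, hy.1⟩
          · push Not at hs
            exact hnew α (hAR ▸ hf.le_of_inPhase hτ hM hα)
              fun s hs' => (hs s hs').le
      -- A request containing a free resource is served by that resource alone, at no cost to the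
      -- algorithm or to any comparator; the budget survives.
      · push Not at hr
        obtain ⟨k, hk, hfree⟩ := hr
        have hraise : ∀ s, Feasible σ s → ∃ t, s ≤ t ∧ Feasible (σ ++ [r]) t ∧ f t ≤ f s ∧
            ∀ j, 0 < f (Pi.single j 1) → t j = s j := by
          intro s hs
          obtain ⟨t, hst, htr, hteq⟩ := Request.exists_raise hk hs.1
          have heq : ∀ j, 0 < f (Pi.single j 1) → t j = s j := fun j hj =>
            hteq j fun h => hfree.not_gt (h ▸ hj)
          have ht := hs.concat hst htr
          exact ⟨t, hst, ht, hf.map_le_of_le_on_costly hs.1 ht.1 fun j hj => (heq j hj).le, heq⟩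
        obtain ⟨y, hxy, hy, hfy, hyeq⟩ := hraise x hx
        refine ⟨y, ⟨hy, ?_⟩, hxy⟩
        rcases hinv with hzero | ⟨α, hα⟩
        · exact Or.inl fun j hj => (hyeq j hj).trans (hzero j hj)
        · obtain ⟨s, hs, hsα⟩ := hα.1
          obtain ⟨t, -, ht, hft, -⟩ := hraise s hs
          exact Or.inr ⟨α, hf.inPhase_concat hα ⟨t, ht, hft.trans hsα⟩
            (hf.charged_of_le (fun s hs => hs.1) hα.pos hxy hfy)⟩)
  refine ⟨alg, fun σ s hs => ?_⟩
  have hfs := hf.nonneg hs.1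
  obtain ⟨hx, hzero | ⟨α, hα⟩⟩ := halg σ
  · refine (hf.map_le_of_le_on_costly le_rfl hx.1 fun j hj => (hzero j hj).le).trans ?_
    rw [hf.map_zero]
    positivity
  · calc f (alg.solution σ) ≤ R * α := hAR ▸ hf.le_of_inPhase hτ hM hα
      _ ≤ R * (4 * 2 ^ τ * f s) := mul_le_mul_of_nonneg_left (hα.2.1 s hs) hR0
      _ = R * (4 * 2 ^ τ) * f s := by ring
      _ ≤ _ := mul_le_mul_of_nonneg_right hratio hfs

end IsMonotoneGradientCost

/-! ### Back to polynomials -/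

theorem IsConvexCost.exists_onlineAlgorithm {p : MvPolynomial (Fin n) ℝ} (hp : IsConvexCost p)
    (hτ : p.totalDegree ≤ τ) {N : ℕ}
    (hcard : (Finset.univ.filter fun j : Fin n => 0 < MvPolynomial.eval (Pi.single j 1)
      (p - MvPolynomial.C (p.coeff 0))).card ≤ N) :
    ∃ alg : OnlineAlgorithm n, alg.IsCompetitive (fun x => MvPolynomial.eval x p)
      ((6144 * (τ : ℝ) * Real.log (max (N : ℝ) 2)) ^ τ) := by
  have hM : (max (N : ℝ) 2) = ((max N 2 : ℕ) : ℝ) := by push_cast; rfl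
  have hdeg : (p - MvPolynomial.C (p.coeff 0)).totalDegree ≤ p.totalDegree :=
    MvPolynomial.totalDegree_sub_C_le _ _
  have hcard' := hcard.trans (le_max_left N 2)
  -- For `τ = 0` the cost is constant and the ratio is `0 ^ 0 = 1`, so any algorithm works; one is
  -- obtained from the degree bound 1.
  rcases Nat.eq_zero_or_pos τ with rfl | hτ1
  · have hcost := hp.sub_C.isMonotoneGradientCost (hdeg.trans (hτ.trans zero_le_one))
      (eval_zero_sub_C p)
    obtain ⟨alg, -⟩ := hcost.exists_onlineAlgorithm le_rfl (le_max_right N 2) hcard'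
    refine ⟨alg, fun σ x _ => ?_⟩
    rw [MvPolynomial.totalDegree_eq_zero_iff_eq_C.1 (Nat.le_zero.1 hτ)]
    simp
  · have hcost := hp.sub_C.isMonotoneGradientCost (hdeg.trans hτ) (eval_zero_sub_C p)
    obtain ⟨alg, halg⟩ := hcost.exists_onlineAlgorithm hτ1 (le_max_right N 2) hcard'
    refine ⟨alg, fun σ x hx => ?_⟩
    have h := halg σ x hx
    simp only [map_sub, MvPolynomial.eval_C] at h
    rw [hM]
    have hτ' : (1 : ℝ) ≤ τ := by exact_mod_cast hτ1
    have hL : 1 / 2 ≤ Real.log ((max N 2 : ℕ) : ℝ) := by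
      have h2 : Real.log 2 ≤ Real.log ((max N 2 : ℕ) : ℝ) :=
        Real.log_le_log two_pos (by exact_mod_cast le_max_right N 2)
      linarith [Real.log_two_gt_d9]
    -- A ratio of at least 1 lets the constant term be added back on both sides.
    have hone : 1 ≤ (6144 * (τ : ℝ) * Real.log ((max N 2 : ℕ) : ℝ)) ^ τ :=
      one_le_pow₀ (by nlinarith)
    have := mul_le_mul_of_nonneg_right hone (hp.1 0)
    linarith

end OnlineCovering

theorem mainTheorem1 :
    ∃ K : ℝ, 0 < K ∧
      -- (a) homogeneous polynomials of degree `τ` in `n` variables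
      (∀ (n τ : ℕ) (p : MvPolynomial (Fin n) ℝ),
        OnlineCovering.IsConvexCost p → p.IsHomogeneous τ →
        ∃ alg : OnlineCovering.OnlineAlgorithm n,
          alg.IsCompetitive (fun x => MvPolynomial.eval x p)
            ((K * (τ : ℝ) * Real.log (max (n : ℝ) 2)) ^ τ)) ∧
      -- (b) polynomials of maximum degree `τ` that are sums of `N` monomials
      (∀ (n τ N : ℕ) (p : MvPolynomial (Fin n) ℝ),
        OnlineCovering.IsConvexCost p → p.totalDegree ≤ τ → p.support.card ≤ N →
        ∃ alg : OnlineCovering.OnlineAlgorithm n,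
          alg.IsCompetitive (fun x => MvPolynomial.eval x p)
            ((K * (τ : ℝ) * Real.log (max (N : ℝ) 2)) ^ τ)) := by
  refine ⟨6144, by norm_num, fun n τ p hp hhom => ?_, fun n τ N p hp hτ hN => ?_⟩
  · exact hp.exists_onlineAlgorithm hhom.totalDegree_le
      ((Finset.card_le_univ _).trans_eq (Fintype.card_fin n))
  · exact hp.exists_onlineAlgorithm hτ
      ((OnlineCovering.card_costly_le_card_support p).trans hN)
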